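/- \textbf{Proposition (Mass production with a larger number of copies).} A \emph{circuit} acts on a data register together with finitely many ancilla qubits that start in, and are returned to, the state $|0\rangle$; its gates are arbitrary one- and two-qubit Clifford gates and Toffoli gates, and for a constant $\Xi>0$ its cost is $\mathrm{Cost}(C)=\#\{\text{Clifford gates}\}+\Xi\cdot\#\{\text{Toffoli gates}\}$. For $f:\{0,1\}^n\to\{0,1\}^m$ let $O_f:|x\rangle|\alpha\rangle\mapsto|x\rangle|\alpha\oplus f(x)\rangle$. For a nonnegative quantity $F(n,f)$ write $F=\widetilde\Theta(g(n))$ if there are $K>0$ and $p\in\mathbb N$, independent of $n$ and $f$, with $g(n)/(Kn^p)\le F(n,f)\le Kn^p g(n)$ for all $n>a$ and all $f:\{0,1\}^n\to\{0,1\}^m$ (factors logarithmic in the exponentially large $g(n)$ are neglected). Let $a\ge 1$ and $m$ be constants. There are circuits $C_{n,f}$, for $n>a$ and $f:\{0,1\}^n\to\{0,1\}^m$, not depending on $\Xi$, such that $C_{n,f}$ implements $O_f^{\otimes r}$ with $r=2^{n-a}$, and such that for every constant $\Xi>0$: \begin{enumerate} \item $\mathrm{Cost}(C_{n,f})=\widetilde\Theta(3^n)$.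 \item The standard QROM circuit for $f$ (iterate over all addresses $x$ by Toffoli gates that compute and uncompute the address-match bit in a chain of ancillas, and XOR $f(x)$ into the output with CNOT gates controlled on that bit) implements $O_f$ and has cost between $c\,2^n$ and $K\,2^n$, with $c,K>0$ independent of $n$ and $f$. \item For every family of circuits $D_{n,f}$ implementing $O_f$ with $\mathrm{Cost}(D_{n,f})=\widetilde\Theta(2^n)$ (in particular the QROM circuits of item 2), the improvement factor is $$\mathcal I=\frac{r\,\mathrm{Cost}(D_{n,f})}{\mathrm{Cost}(C_{n,f})}=\widetilde\Theta\!\left(2^{n(2-\log_2 3)}\right),$$ which is polynomial in $2^n$. \end{enumerate} -/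

import Mathlib

open Matrix

namespace MassProduction

/-- Operators on the qubits labelled by `W`, in the computational basis `W → Bool`. -/
abbrev Op (W : Type) := Matrix (W → Bool) (W → Bool) ℂ

/-- The operator `|y⟩ ↦ |σ y⟩` determined by a map on computational basis states. -/
def classicalOp {W : Type} [Fintype W] [DecidableEq W] (σ : (W → Bool) → (W → Bool)) : Op W :=
  Matrix.of fun x y => if x = σ y then 1 else 0

/-! ### Pauli and Clifford operators -/

/-- The `k`-qubit Pauli operator `i ^ c · X ^ u · Z ^ v`, that is
`|y⟩ ↦ i ^ c (-1) ^ (v · y) |y ⊕ u⟩`. -/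
noncomputable def pauliOp {k : ℕ} (c : ℕ) (u v : Fin k → Bool) : Op (Fin k) :=
  Matrix.of fun x y =>
    if x = fun j => xor (y j) (u j) then
      Complex.I ^ c * ∏ j, (if (v j && y j) = true then (-1 : ℂ) else 1)
    else 0

/-- Membership in the `k`-qubit Pauli group, with phases `1, i, -1, -i`. -/
def IsPauli {k : ℕ} (P : Op (Fin k)) : Prop :=
  ∃ (c : ℕ) (u v : Fin k → Bool), P = pauliOp c u v

/-- A `k`-qubit Clifford operator: a unitary that conjugates Pauli operators to Pauli operators. -/
def IsClifford {k : ℕ} (U : Op (Fin k)) : Prop :=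
  U ∈ Matrix.unitaryGroup (Fin k → Bool) ℂ ∧ ∀ P, IsPauli P → IsPauli (U * P * star U)

/-! ### Circuits -/

/-- The three-qubit Toffoli gate, `|a, b, c⟩ ↦ |a, b, c ⊕ (a ∧ b)⟩`. -/
def toffoliOp : Op (Fin 3) :=
  classicalOp fun b => Function.update b 2 (xor (b 2) (b 0 && b 1))

/-- A gate on the qubits `W`: an arbitrary one-qubit Clifford gate, an arbitrary two-qubit Clifford
gate, or a Toffoli gate, together with the distinct qubits it is applied to. -/
inductive Gate (W : Type) : Type where
  | cliffordOne (U : Op (Fin 1)) (hU : IsClifford U) (e : Fin 1 ↪ W) : Gate W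
  | cliffordTwo (U : Op (Fin 2)) (hU : IsClifford U) (e : Fin 2 ↪ W) : Gate W
  | toffoli (e : Fin 3 ↪ W) : Gate W

/-- The operator on all qubits that acts as `U` on the qubits `e 0, …, e (k - 1)` and trivially on
the others. -/
def applyAt {W : Type} [Fintype W] [DecidableEq W] {k : ℕ} (U : Op (Fin k)) (e : Fin k ↪ W) :
    Op W :=
  Matrix.of fun x y =>
    if ∀ w, (∀ i, e i ≠ w) → x w = y w then U (fun i => x (e i)) (fun i => y (e i)) else 0

/-- The unitary of a gate. -/
def Gate.toOp {W : Type} [Fintype W] [DecidableEq W] : Gate W → Op W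
  | .cliffordOne U _ e => applyAt U e
  | .cliffordTwo U _ e => applyAt U e
  | .toffoli e => applyAt toffoliOp e

/-- Whether a gate is counted as a Toffoli gate (otherwise it is counted as a Clifford gate). -/
def Gate.isToffoli {W : Type} : Gate W → Bool
  | .cliffordOne _ _ _ => false
  | .cliffordTwo _ _ _ => false
  | .toffoli _ => true

/-- A Clifford + Toffoli circuit acting on a data register `Q` and on finitely many ancilla
qubits. The gates are listed in the order in which they are applied. -/
structure Circuit (Q : Type) where
  ancillas : ℕ
  gates : List (Gate (Q ⊕ Fin ancillas))

/-- The unitary of a circuit. -/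
noncomputable def Circuit.toOp {Q : Type} [Fintype Q] [DecidableEq Q] (C : Circuit Q) :
    Op (Q ⊕ Fin C.ancillas) :=
  C.gates.foldl (fun M g => g.toOp * M) 1

/-- The state `|ψ⟩|0…0⟩`, with `s` ancilla qubits in the zero state. -/
def withAncillas {Q : Type} (s : ℕ) (ψ : (Q → Bool) → ℂ) : (Q ⊕ Fin s → Bool) → ℂ :=
  fun b => if ∀ i, b (Sum.inr i) = false then ψ (fun q => b (Sum.inl q)) else 0

/-- The circuit implements the operator `V` on its data register: it maps `|ψ⟩|0…0⟩` to
`(V|ψ⟩)|0…0⟩` for every `ψ`. -/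
def Circuit.Implements {Q : Type} [Fintype Q] [DecidableEq Q] (C : Circuit Q) (V : Op Q) : Prop :=
  ∀ ψ : (Q → Bool) → ℂ,
    C.toOp *ᵥ withAncillas C.ancillas ψ = withAncillas C.ancillas (V *ᵥ ψ)

/-- The number of one- and two-qubit Clifford gates. -/
def Circuit.cliffordCount {Q : Type} (C : Circuit Q) : ℕ :=
  C.gates.countP fun g => !g.isToffoli

/-- The number of Toffoli gates. -/
def Circuit.toffoliCount {Q : Type} (C : Circuit Q) : ℕ :=
  C.gates.countP fun g => g.isToffoli

/-- The cost of a circuit when a Clifford gate has cost `1` and a Toffoli gate has cost `Ξ`. -/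
def Circuit.cost {Q : Type} (Ξ : ℝ) (C : Circuit Q) : ℝ :=
  (C.cliffordCount : ℝ) + Ξ * (C.toffoliCount : ℝ)

/-! ### Data loading -/

/-- Boolean functions with `n` input bits and `m` output bits. -/
abbrev BoolFun (n m : ℕ) := (Fin n → Bool) → (Fin m → Bool)

/-- The query oracle `O_f : |x⟩|α⟩ ↦ |x⟩|α ⊕ f x⟩`. -/
def oracle {n m : ℕ} (f : BoolFun n m) : Op (Fin n ⊕ Fin m) :=
  classicalOp fun b =>
    Sum.elim (fun i => b (Sum.inl i))
      (fun j => xor (b (Sum.inr j)) (f (fun i => b (Sum.inl i)) j))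

/-- The tensor power `V^{⊗ r}`, acting on `r` copies of the register `Q`. -/
noncomputable def tensorPower {Q : Type} (r : ℕ) (V : Op Q) : Op (Fin r × Q) :=
  Matrix.of fun x y => ∏ i, V (fun q => x (i, q)) (fun q => y (i, q))

/-! ### The standard QROM circuit (unary iteration) -/

/-- The one-qubit NOT gate. -/
def xOp : Op (Fin 1) := classicalOp fun b => Function.update b 0 (!b 0)

/-- The two-qubit CNOT gate, `|a, b⟩ ↦ |a, b ⊕ a⟩`. -/
def cnotOp : Op (Fin 2) := classicalOp fun b => Function.update b 1 (xor (b 1) (b 0))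

theorem classicalOp_mul_mul_star {W : Type} [Fintype W] [DecidableEq W]
    {σ : (W → Bool) → (W → Bool)} (hσ : ∀ b, σ (σ b) = b) (P : Op W) :
    classicalOp σ * P * star (classicalOp σ) = P.submatrix σ σ := by
  have key : ∀ x y, x = σ y ↔ σ x = y := fun x y =>
    ⟨fun h => by rw [h, hσ], fun h => by rw [← h, hσ]⟩
  have h : classicalOp σ = Matrix.of fun x y => if σ x = y then (1 : ℂ) else 0 := by
    ext x y
    simp only [classicalOp, Matrix.of_apply, key]
  rw [h]
  ext x y
  simp [Matrix.mul_apply, Matrix.star_apply, apply_ite (star (R := ℂ))]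

theorem classicalOp_mem_unitaryGroup {W : Type} [Fintype W] [DecidableEq W]
    {σ : (W → Bool) → (W → Bool)} (hσ : ∀ b, σ (σ b) = b) :
    classicalOp σ ∈ Matrix.unitaryGroup (W → Bool) ℂ := by
  rw [Matrix.mem_unitaryGroup_iff]
  have h := classicalOp_mul_mul_star hσ (1 : Op W)
  rw [mul_one] at h
  rw [h]
  exact Matrix.submatrix_one σ (fun a b hab => by rw [← hσ a, hab, hσ])

theorem isClifford_xOp : IsClifford xOp := by
  have hσ : ∀ b : Fin 1 → Bool, Function.update (Function.update b 0 (!b 0)) 0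
      (!(Function.update b 0 (!b 0)) 0) = b := by decide
  refine ⟨classicalOp_mem_unitaryGroup hσ, ?_⟩
  rintro P ⟨c, u, v, rfl⟩
  refine ⟨c + if v 0 = true then 2 else 0, u, v, ?_⟩
  rw [xOp, classicalOp_mul_mul_star hσ]
  ext x y
  simp only [pauliOp, Matrix.submatrix_apply, Matrix.of_apply, funext_iff, Fin.forall_fin_one,
    Function.update_self, Fin.prod_univ_one]
  cases x 0 <;> cases y 0 <;> cases u 0 <;> cases v 0 <;> simp [pow_add]

theorem isClifford_cnotOp : IsClifford cnotOp := by
  have hσ : ∀ b : Fin 2 → Bool,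
      Function.update (Function.update b 1 (xor (b 1) (b 0))) 1
        (xor ((Function.update b 1 (xor (b 1) (b 0))) 1)
          ((Function.update b 1 (xor (b 1) (b 0))) 0)) = b := by decide
  refine ⟨classicalOp_mem_unitaryGroup hσ, ?_⟩
  rintro P ⟨c, u, v, rfl⟩
  refine ⟨c, ![u 0, xor (u 1) (u 0)], ![xor (v 0) (v 1), v 1], ?_⟩
  rw [cnotOp, classicalOp_mul_mul_star hσ]
  ext x y
  simp only [pauliOp, Matrix.submatrix_apply, Matrix.of_apply, funext_iff, Fin.forall_fin_two,
    Function.update_self, Fin.prod_univ_two, Matrix.cons_val_zero, Matrix.cons_val_one,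
    Function.update_of_ne (zero_ne_one : (0 : Fin 2) ≠ 1)]
  cases x 0 <;> cases x 1 <;> cases y 0 <;> cases y 1 <;> cases u 0 <;> cases u 1 <;>
    cases v 0 <;> cases v 1 <;> simp

/-- NOT on qubit `w`. -/
def Gate.notAt {W : Type} (w : W) : Gate W :=
  .cliffordOne xOp isClifford_xOp ⟨fun _ => w, fun _ _ _ => Subsingleton.elim _ _⟩

/-- CNOT with control `p` and target `q`. -/
def Gate.cnotAt {W : Type} (p q : W) (h : p ≠ q) : Gate W :=
  .cliffordTwo cnotOp isClifford_cnotOp ⟨![p, q], by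
    intro i j hij
    fin_cases i <;> fin_cases j <;> simp_all⟩

/-- Toffoli with controls `p`, `q` and target `s`. -/
def Gate.toffoliAt {W : Type} (p q s : W) (hpq : p ≠ q) (hps : p ≠ s) (hqs : q ≠ s) : Gate W :=
  .toffoli ⟨![p, q, s], by
    intro i j hij
    fin_cases i <;> fin_cases j <;> simp_all⟩

/-- Unary iteration over the input bits `0, …, k - 1`, the remaining bits of the address being
fixed as in `x`, controlled on ancilla `k`. The recursion computes into ancilla `k - 1` the
conjunction of ancilla `k` with the condition that input bit `k - 1` is `0` (then `1`), and iterates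
over the lower bits; at the bottom, `f x` is XORed into the output register by CNOT gates. -/
def unaryIteration {n m : ℕ} (f : BoolFun n m) :
    (k : ℕ) → k ≤ n → (Fin n → Bool) → List (Gate ((Fin n ⊕ Fin m) ⊕ Fin (n + 1)))
  | 0, _, x =>
      ((List.finRange m).filter fun j => f x j).map fun j =>
        Gate.cnotAt (Sum.inr 0) (Sum.inl (Sum.inr j)) (by simp)
  | k + 1, hk, x =>
      let i : Fin n := ⟨k, hk⟩
      let bit : (Fin n ⊕ Fin m) ⊕ Fin (n + 1) := Sum.inl (Sum.inl i)
      let ctrl : (Fin n ⊕ Fin m) ⊕ Fin (n + 1) := Sum.inr i.succ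
      let next : (Fin n ⊕ Fin m) ⊕ Fin (n + 1) := Sum.inr i.castSucc
      have hcn : ctrl ≠ next := by simp [ctrl, next, Fin.ext_iff]
      let and : Gate ((Fin n ⊕ Fin m) ⊕ Fin (n + 1)) :=
        Gate.toffoliAt ctrl bit next (by simp [ctrl, bit]) hcn (by simp [bit, next])
      [Gate.notAt bit, and, Gate.notAt bit]
        ++ unaryIteration f k (Nat.le_of_succ_le hk) (Function.update x i false)
        ++ [Gate.cnotAt ctrl next hcn]
        ++ unaryIteration f k (Nat.le_of_succ_le hk) (Function.update x i true)
        ++ [and]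

/-- The standard QROM circuit for a single query to `f`. -/
def qrom {n m : ℕ} (f : BoolFun n m) : Circuit (Fin n ⊕ Fin m) where
  ancillas := n + 1
  gates := [Gate.notAt (Sum.inr (Fin.last n))] ++ unaryIteration f n le_rfl (fun _ => false)
    ++ [Gate.notAt (Sum.inr (Fin.last n))]

/-! ### Asymptotics -/

/-- `F n f = Θ̃(g n)` for `n > a`, uniformly in the function `f`. The neglected logarithmic factors
are powers of `n` (all `g` in question are exponential in `n`). -/
def IsSoftTheta {m : ℕ} (a : ℕ) (F : (n : ℕ) → BoolFun n m → ℝ) (g : ℕ → ℝ) : Prop :=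
  ∃ (K : ℝ) (p : ℕ), 0 < K ∧ ∀ n, a < n → ∀ f : BoolFun n m,
    g n / (K * (n : ℝ) ^ p) ≤ F n f ∧ F n f ≤ K * (n : ℝ) ^ p * g n

/-- The factor `r · Cost(D) / Cost(C)` by which a circuit `C` for `r` parallel queries improves on
`r` uses of a circuit `D` for one query. -/
noncomputable def improvementFactor {Q Q' : Type} (Ξ : ℝ) (r : ℕ) (D : Circuit Q)
    (C : Circuit Q') : ℝ :=
  (r : ℝ) * D.cost Ξ / C.cost Ξ

end MassProduction

/-!
Two queries to a function `f` with address bits `(t, v)`, `t` the leading one, can be answered by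
one query to each of three functions of `v`: the restrictions `f₀`, `f₁` and their sum `f₀ ⊕ f₁`.
Indeed the first query `(t, v)` needs `f_t v`, and the second query `(t', v')` needs
`f_{1-t} v'` if `t ≠ t'` and `f_{1-t} v' ⊕ (f₀ ⊕ f₁) v'` if `t = t'`. Exchanging the two registers
controlled on `t` lets `f₀` act on the one and `f₁` on the other. Discarding the
result of the query to `f₀ ⊕ f₁` if `t ≠ t'` would take a second query to uncompute it; instead the
query is then made at the address `0`, where its result is a constant that CNOT gates cancel. See `pairStep` and `pairStep_query`.

Applied to all pairs among `2 ^ (k + 1)` queries in parallel, this gives the recursion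
`Realizes.queryMap_succ`: `T (n + 1, k + 1) = 3 T (n, k) + O (2 ^ k n)` for the number `T (n, k)` of
gates for `2 ^ k` queries with `n` address bits. After `k = n - a` steps there remain `3 ^ k` single
queries to functions of `a` bits, which unary iteration answers with a constant number of gates.
Hence `T (n, n - a)` is `3 ^ n` up to constants and a polynomial factor in `n`
(`realizes_inParallel_queryMap`); the lower bound is the number of single queries.

All gates used are NOT, CNOT and Toffoli gates, so that it suffices to follow computational basis
states. The predicate `Realizes` says that a map on bit strings is computed by such gates with clean
ancilla bits and a number of gates in a given range; it is stable under composition, enlarging the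
register and hiding ancilla bits, and `Realizes.exists_circuit` turns it into a statement about
unitaries. The cost of a circuit and its number of gates agree up to the constants `min 1 Ξ` and
`max 1 Ξ`, so the number of gates decides every asymptotic statement.
-/

namespace MassProduction

/-! ### Classical reversible circuits -/

/-- A classical reversible gate on the bits `W`: NOT, CNOT (control `p`, target `q`), or Toffoli
(controls `p`, `q`, target `t`). -/
inductive ClassicalGate (W : Type) : Type where
  | not (w : W) : ClassicalGate W
  | cnot (p q : W) (h : p ≠ q) : ClassicalGate W
  | toffoli (p q t : W) (hpq : p ≠ q) (hpt : p ≠ t) (hqt : q ≠ t) : ClassicalGate W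

namespace ClassicalGate

variable {W W' : Type}

/-- The action of a classical gate on bit strings. -/
def act [DecidableEq W] : ClassicalGate W → (W → Bool) → (W → Bool)
  | .not w, s => Function.update s w (!s w)
  | .cnot p q _, s => Function.update s q (xor (s q) (s p))
  | .toffoli p q t _ _ _, s => Function.update s t (xor (s t) (s p && s q))

/-- The quantum gate that permutes the computational basis by the classical gate. -/
def toGate : ClassicalGate W → Gate W
  | .not w => Gate.notAt w
  | .cnot p q h => Gate.cnotAt p q h
  | .toffoli p q t hpq hpt hqt => Gate.toffoliAt p q t hpq hpt hqt

/-- Relabelling of the bits of a gate along an injection. -/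
def map (e : W ↪ W') : ClassicalGate W → ClassicalGate W'
  | .not w => .not (e w)
  | .cnot p q h => .cnot (e p) (e q) (e.injective.ne h)
  | .toffoli p q t hpq hpt hqt =>
      .toffoli (e p) (e q) (e t) (e.injective.ne hpq) (e.injective.ne hpt) (e.injective.ne hqt)

/-- The action of a list of gates, applied in order. -/
def run [DecidableEq W] (l : List (ClassicalGate W)) (s : W → Bool) : W → Bool :=
  l.foldl (fun s g => g.act s) s

section Run

variable [DecidableEq W]

@[simp] theorem act_not (w : W) (s : W → Bool) :
    (ClassicalGate.not w).act s = Function.update s w (!s w) := rfl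

@[simp] theorem act_cnot {p q : W} (h : p ≠ q) (s : W → Bool) :
    (cnot p q h).act s = Function.update s q (xor (s q) (s p)) := rfl

@[simp] theorem act_toffoli {p q t : W} (hpq : p ≠ q) (hpt : p ≠ t) (hqt : q ≠ t)
    (s : W → Bool) :
    (toffoli p q t hpq hpt hqt).act s = Function.update s t (xor (s t) (s p && s q)) := rfl

@[simp] theorem run_nil (s : W → Bool) : run [] s = s := rfl

@[simp] theorem run_cons (g : ClassicalGate W) (l : List (ClassicalGate W)) (s : W → Bool) :
    run (g :: l) s = run l (g.act s) := rfl

@[simp] theorem run_append (l l' : List (ClassicalGate W)) (s : W → Bool) :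
    run (l ++ l') s = run l' (run l s) := by
  simp [run]

end Run

section Map

variable [DecidableEq W']

theorem act_map_of_notMem (e : W ↪ W') (g : ClassicalGate W) (s : W' → Bool) {w' : W'}
    (hw : ∀ w, e w ≠ w') : (g.map e).act s w' = s w' := by
  cases g <;> simp [map, (hw _).symm]

theorem run_map_of_notMem (e : W ↪ W') (l : List (ClassicalGate W)) (s : W' → Bool) {w' : W'}
    (hw : ∀ w, e w ≠ w') : run (l.map (map e)) s w' = s w' := by
  induction l generalizing s with
  | nil => rfl
  | cons g l ih => rw [List.map_cons, run_cons, ih, act_map_of_notMem e g s hw]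

variable [DecidableEq W]

theorem act_map (e : W ↪ W') (g : ClassicalGate W) (s : W' → Bool) :
    (g.map e).act s ∘ e = g.act (s ∘ e) := by
  funext w
  cases g <;> simp [map, Function.update_apply]

theorem run_map (e : W ↪ W') (l : List (ClassicalGate W)) (s : W' → Bool) :
    run (l.map (map e)) s ∘ e = run l (s ∘ e) := by
  induction l generalizing s with
  | nil => rfl
  | cons g l ih => rw [List.map_cons, run_cons, run_cons, ih, act_map]

theorem run_map_apply (e : W ↪ W') (l : List (ClassicalGate W)) (s : W' → Bool) (w : W) :
    run (l.map (map e)) s (e w) = run l (s ∘ e) w :=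
  congrFun (run_map e l s) w

end Map

end ClassicalGate

/-! ### Operators of classical circuits -/

section Operators

variable {W : Type} [Fintype W] [DecidableEq W]

theorem classicalOp_mul_classicalOp (σ τ : (W → Bool) → (W → Bool)) :
    classicalOp σ * classicalOp τ = classicalOp (σ ∘ τ) := by
  ext x y
  simp [classicalOp, Matrix.mul_apply]

theorem classicalOp_id : classicalOp (fun s : W → Bool => s) = 1 := by
  ext x y
  simp [classicalOp, Matrix.one_apply]

theorem applyAt_classicalOp {k : ℕ} (τ : (Fin k → Bool) → (Fin k → Bool)) (e : Fin k ↪ W)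
    (σ : (W → Bool) → (W → Bool)) (h₁ : ∀ y i, σ y (e i) = τ (fun i => y (e i)) i)
    (h₂ : ∀ y w, (∀ i, e i ≠ w) → σ y w = y w) :
    applyAt (classicalOp τ) e = classicalOp σ := by
  ext x y
  simp only [applyAt, classicalOp, Matrix.of_apply, ← ite_and]
  refine if_congr ⟨fun ⟨h, h'⟩ => funext fun w => ?_, ?_⟩ rfl rfl
  · by_cases hw : ∃ i, e i = w
    · obtain ⟨i, rfl⟩ := hw
      rw [h₁]
      exact congrFun h' i
    · push Not at hw
      rw [h₂ y w hw, h w hw]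
  · rintro rfl
    exact ⟨fun w hw => h₂ y w hw, funext fun i => h₁ y i⟩

theorem ClassicalGate.toOp_toGate (g : ClassicalGate W) :
    g.toGate.toOp = classicalOp g.act := by
  cases g with
  | not w =>
    refine applyAt_classicalOp _ _ _ (fun y i => ?_) (fun y v hv => ?_)
    · obtain rfl : i = 0 := Subsingleton.elim _ _
      exact (Function.update_self w (!y w) y).trans
        (Function.update_self (0 : Fin 1) (!y w) fun _ => y w).symm
    · exact Function.update_of_ne (hv 0).symm _ _
  | cnot p q h =>
    refine applyAt_classicalOp _ _ _ (fun y i => ?_) (fun y v hv => ?_)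
    · fin_cases i
      · exact Function.update_of_ne h _ _
      · exact Function.update_self ..
    · exact Function.update_of_ne (hv 1).symm _ _
  | toffoli p q t hpq hpt hqt =>
    refine applyAt_classicalOp _ _ _ (fun y i => ?_) (fun y v hv => ?_)
    · fin_cases i
      · exact Function.update_of_ne hpt _ _
      · exact Function.update_of_ne hqt _ _
      · exact Function.update_self ..
    · exact Function.update_of_ne (hv 2).symm _ _

theorem foldl_toOp_toGate (l : List (ClassicalGate W)) (σ : (W → Bool) → (W → Bool)) :
    (l.map ClassicalGate.toGate).foldl (fun M g => g.toOp * M) (classicalOp σ) =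
      classicalOp (fun s => ClassicalGate.run l (σ s)) := by
  induction l generalizing σ with
  | nil => rfl
  | cons g l ih =>
    rw [List.map_cons, List.foldl_cons, ClassicalGate.toOp_toGate, classicalOp_mul_classicalOp, ih]
    rfl

end Operators

/-- A circuit of classical gates that computes `σ` on the data bits and restores the zero ancilla
bits implements the operator of `σ`: it suffices to look at computational basis states. -/
theorem implements_classicalOp {Q : Type} [Fintype Q] [DecidableEq Q] {s : ℕ}
    {l : List (ClassicalGate (Q ⊕ Fin s))} {σ : (Q → Bool) → (Q → Bool)}
    (h : ∀ q, ClassicalGate.run l (Sum.elim q fun _ => false) = Sum.elim (σ q) fun _ => false) :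
    (Circuit.mk s (l.map ClassicalGate.toGate)).Implements (classicalOp σ) := by
  intro ψ
  have hop : (Circuit.mk s (l.map ClassicalGate.toGate)).toOp =
      classicalOp (ClassicalGate.run l) := by
    have := foldl_toOp_toGate l (fun s => s)
    rw [classicalOp_id] at this
    exact this
  rw [hop]
  ext x
  change ∑ y, classicalOp (ClassicalGate.run l) x y * withAncillas s ψ y = _
  rw [← (Equiv.sumArrowEquivProdArrow Q (Fin s) Bool).symm.sum_comp, Fintype.sum_prod_type]
  have hinner : ∀ q : Q → Bool, ∑ z : Fin s → Bool,
      classicalOp (ClassicalGate.run l) x ((Equiv.sumArrowEquivProdArrow Q (Fin s) Bool).symm (q, z))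
        * withAncillas s ψ ((Equiv.sumArrowEquivProdArrow Q (Fin s) Bool).symm (q, z)) =
      if x = Sum.elim (σ q) (fun _ => false) then ψ q else 0 := by
    intro q
    rw [Finset.sum_eq_single (fun _ => false)]
    · have hsymm : (Equiv.sumArrowEquivProdArrow Q (Fin s) Bool).symm (q, fun _ => false) =
          Sum.elim q fun _ => false := rfl
      rw [hsymm]
      simp [classicalOp, withAncillas, h]
    · intro z _ hz
      have : ¬ ∀ i, z i = false := fun h' => hz (funext h')
      have hw : withAncillas s ψ ((Equiv.sumArrowEquivProdArrow Q (Fin s) Bool).symm (q, z)) = 0 :=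
        if_neg this
      rw [hw, mul_zero]
    · simp
  simp only [hinner]
  by_cases hx : ∀ i, x (Sum.inr i) = false
  · have hiff : ∀ q, x = Sum.elim (σ q) (fun _ => false) ↔ (fun q => x (Sum.inl q)) = σ q := by
      intro q
      constructor
      · intro h'
        rw [h']
        rfl
      · intro h'
        rw [← h']
        funext w
        cases w with
        | inl w => rfl
        | inr w => exact hx w
    simp only [withAncillas, hx, implies_true, if_true, hiff]
    simp [Matrix.mulVec, dotProduct, classicalOp]
  · have hne : ∀ q, x ≠ Sum.elim (σ q) (fun _ => false) := by
      rintro q rfl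
      exact hx fun _ => rfl
    simp [withAncillas, hx, hne]

/-! ### Maps realized by classical circuits -/

/-- The map `σ` applied to each of the registers `{j} × Q`. -/
def inParallel {Q : Type} (J : Type) (σ : (Q → Bool) → (Q → Bool)) (s : J × Q → Bool) :
    J × Q → Bool :=
  fun w => σ (fun q => s (w.1, q)) w.2

theorem inParallel_comp {Q J : Type} (σ τ : (Q → Bool) → (Q → Bool)) (s : J × Q → Bool) :
    inParallel J τ (inParallel J σ s) = inParallel J (fun s => τ (σ s)) s := rfl

/-- The map `σ` on bit strings is computed, with ancilla bits that start and end in `0`, by a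
circuit whose number of classical gates lies between `lo` and `hi`. -/
def Realizes {Q : Type} [DecidableEq Q] (σ : (Q → Bool) → (Q → Bool)) (lo hi : ℕ) : Prop :=
  ∃ (A : Type) (_ : Fintype A) (_ : DecidableEq A) (l : List (ClassicalGate (Q ⊕ A))),
    (∀ q, ClassicalGate.run l (Sum.elim q fun _ => false) = Sum.elim (σ q) fun _ => false) ∧
      lo ≤ l.length ∧ l.length ≤ hi

namespace Realizes

open ClassicalGate

variable {Q Q' : Type} [DecidableEq Q] [DecidableEq Q']

theorem mono {σ : (Q → Bool) → (Q → Bool)} {lo hi lo' hi' : ℕ} (h : Realizes σ lo hi)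
    (hlo : lo' ≤ lo) (hhi : hi ≤ hi') : Realizes σ lo' hi' := by
  obtain ⟨A, _, _, l, hl, h₁, h₂⟩ := h
  exact ⟨A, inferInstance, inferInstance, l, hl, hlo.trans h₁, h₂.trans hhi⟩

theorem id : Realizes (fun s : Q → Bool => s) 0 0 :=
  ⟨Empty, inferInstance, inferInstance, [], fun _ => rfl, le_rfl, le_rfl⟩

theorem single (g : ClassicalGate Q) : Realizes g.act 1 1 := by
  refine ⟨Empty, inferInstance, inferInstance, [g.map Function.Embedding.inl], fun q => ?_,
    le_rfl, le_rfl⟩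
  funext v
  rcases v with v | v
  · exact run_map_apply Function.Embedding.inl [g] (Sum.elim q fun _ => false) v
  · exact v.elim

theorem not (w : Q) : Realizes (fun s => Function.update s w (!s w)) 1 1 :=
  single (.not w)

theorem cnot {p t : Q} (h : p ≠ t) :
    Realizes (fun s => Function.update s t (xor (s t) (s p))) 1 1 :=
  single (.cnot p t h)

theorem toffoli {p q t : Q} (hpq : p ≠ q) (hpt : p ≠ t) (hqt : q ≠ t) :
    Realizes (fun s => Function.update s t (xor (s t) (s p && s q))) 1 1 :=
  single (.toffoli p q t hpq hpt hqt)

theorem comp {σ τ : (Q → Bool) → (Q → Bool)} {lo hi lo' hi' : ℕ} (hσ : Realizes σ lo hi)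
    (hτ : Realizes τ lo' hi') : Realizes (fun s => τ (σ s)) (lo + lo') (hi + hi') := by
  obtain ⟨A, _, _, l, hl, h₁, h₂⟩ := hσ
  obtain ⟨B, _, _, l', hl', h₁', h₂'⟩ := hτ
  let eA : Q ⊕ A ↪ Q ⊕ (A ⊕ B) := (Function.Embedding.refl Q).sumMap Function.Embedding.inl
  let eB : Q ⊕ B ↪ Q ⊕ (A ⊕ B) := (Function.Embedding.refl Q).sumMap Function.Embedding.inr
  refine ⟨A ⊕ B, inferInstance, inferInstance, l.map (map eA) ++ l'.map (map eB), fun q => ?_,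
    by simpa using add_le_add h₁ h₁', by simpa using add_le_add h₂ h₂'⟩
  have hzero : ∀ q : Q → Bool, (Sum.elim q fun _ : A ⊕ B => false) ∘ eA =
      Sum.elim q fun _ => false := fun q => by funext w; rcases w with w | w <;> rfl
  have hzero' : ∀ q : Q → Bool, (Sum.elim q fun _ : A ⊕ B => false) ∘ eB =
      Sum.elim q fun _ => false := fun q => by funext w; rcases w with w | w <;> rfl
  have hA : run (l.map (map eA)) (Sum.elim q fun _ => false) = Sum.elim (σ q) fun _ => false := by
    have key := run_map_apply eA l (Sum.elim q fun _ => false)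
    rw [hzero, hl] at key
    funext w
    rcases w with w | w | w
    · exact key (Sum.inl w)
    · exact key (Sum.inr w)
    · exact run_map_of_notMem eA l _ (by rintro (v | v) <;> simp [eA])
  have hB : run (l'.map (map eB)) (Sum.elim (σ q) fun _ => false) =
      Sum.elim (τ (σ q)) fun _ => false := by
    have key := run_map_apply eB l' (Sum.elim (σ q) fun _ => false)
    rw [hzero', hl'] at key
    funext w
    rcases w with w | w | w
    · exact key (Sum.inl w)
    · exact run_map_of_notMem eB l' _ (by rintro (v | v) <;> simp [eB])
    · exact key (Sum.inr w)
  rw [run_append, hA, hB]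

/-- A circuit may be applied to part of a larger register. -/
theorem lift {σ : (Q → Bool) → (Q → Bool)} {lo hi : ℕ} (hσ : Realizes σ lo hi) (e : Q ↪ Q')
    {τ : (Q' → Bool) → (Q' → Bool)} (h₁ : ∀ s q, τ s (e q) = σ (fun q => s (e q)) q)
    (h₂ : ∀ s w, (∀ q, e q ≠ w) → τ s w = s w) : Realizes τ lo hi := by
  obtain ⟨A, _, _, l, hl, hlo, hhi⟩ := hσ
  let eA : Q ⊕ A ↪ Q' ⊕ A := e.sumMap (Function.Embedding.refl A)
  refine ⟨A, inferInstance, inferInstance, l.map (map eA), fun s => ?_, by simpa using hlo,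
    by simpa using hhi⟩
  have key := run_map_apply eA l (Sum.elim s fun _ => false)
  have hzero : (Sum.elim s fun _ : A => false) ∘ eA =
      Sum.elim (fun q => s (e q)) fun _ => false := by
    funext w; rcases w with w | w <;> rfl
  rw [hzero, hl] at key
  funext w
  rcases w with w | w
  · by_cases hw : ∃ q, e q = w
    · obtain ⟨q, rfl⟩ := hw
      exact (key (Sum.inl q)).trans (h₁ s q).symm
    · push Not at hw
      refine (run_map_of_notMem eA l _ ?_).trans (h₂ s w hw).symm
      rintro (v | v)
      · simpa [eA] using hw v
      · simp [eA]
  · exact key (Sum.inr w)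

/-- The bits outside the range of `e` may be used as ancilla bits, provided that they are returned
to `0`. For an equivalence `e` this is a relabelling of the register. -/
theorem restrict [Fintype Q'] {σ : (Q' → Bool) → (Q' → Bool)} {lo hi : ℕ} (hσ : Realizes σ lo hi)
    (e : Q ↪ Q') {τ : (Q → Bool) → (Q → Bool)}
    (h₁ : ∀ s, (∀ w, (∀ q, e q ≠ w) → s w = false) → ∀ q, σ s (e q) = τ (fun q => s (e q)) q)
    (h₂ : ∀ s, (∀ w, (∀ q, e q ≠ w) → s w = false) → ∀ w, (∀ q, e q ≠ w) → σ s w = false) :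
    Realizes τ lo hi := by
  classical
  obtain ⟨A, _, _, l, hl, hlo, hhi⟩ := hσ
  -- The ancilla bits labelled by the range of `e` are never used.
  let φ : Q' ⊕ A → Q ⊕ (Q' ⊕ A) := Sum.elim
    (fun w => if h : ∃ q, e q = w then Sum.inl h.choose else Sum.inr (Sum.inl w))
    (fun i => Sum.inr (Sum.inr i))
  have hφ : ∀ q, φ (Sum.inl (e q)) = Sum.inl q := by
    intro q
    have h : ∃ q', e q' = e q := ⟨q, rfl⟩
    simp only [φ, Sum.elim_inl, dif_pos h]
    exact congrArg Sum.inl (e.injective h.choose_spec)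
  have hφ' : ∀ w, (∀ q, e q ≠ w) → φ (Sum.inl w) = Sum.inr (Sum.inl w) := by
    intro w hw
    have h : ¬ ∃ q, e q = w := by simpa using hw
    simp only [φ, Sum.elim_inl, dif_neg h]
  have hinj : Function.Injective φ := by
    have hcase : ∀ w, (∃ q, e q = w) ∨ ∀ q, e q ≠ w := fun w => by
      by_cases h : ∃ q, e q = w
      · exact Or.inl h
      · exact Or.inr (by simpa using h)
    rintro (v | v) (w | w) hvw
    · rcases hcase v with ⟨q, rfl⟩ | hv <;> rcases hcase w with ⟨q', rfl⟩ | hw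
      · rw [hφ, hφ] at hvw
        rw [Sum.inl.inj hvw]
      · rw [hφ, hφ' w hw] at hvw
        cases hvw
      · rw [hφ, hφ' v hv] at hvw
        cases hvw
      · rw [hφ' w hw, hφ' v hv] at hvw
        cases hvw
        rfl
    · rcases hcase v with ⟨q, rfl⟩ | hv
      · rw [hφ] at hvw
        cases hvw
      · rw [hφ' v hv] at hvw
        cases hvw
    · rcases hcase w with ⟨q, rfl⟩ | hw
      · rw [hφ] at hvw
        cases hvw
      · rw [hφ' w hw] at hvw
        cases hvw
    · cases hvw
      rfl
  refine ⟨Q' ⊕ A, inferInstance, inferInstance, l.map (map ⟨φ, hinj⟩), fun q => ?_,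
    by simpa using hlo, by simpa using hhi⟩
  let s : Q' → Bool := fun w => Sum.elim q (fun _ => false) (φ (Sum.inl w))
  have hs : ∀ w, (∀ q, e q ≠ w) → s w = false := fun w hw => by
    simp only [s, hφ' w hw, Sum.elim_inr]
  have hsq : (fun q => s (e q)) = q := by
    funext q'
    simp only [s, hφ, Sum.elim_inl]
  have hstart : (Sum.elim q fun _ : Q' ⊕ A => false) ∘ (⟨φ, hinj⟩ : Q' ⊕ A ↪ Q ⊕ (Q' ⊕ A)) =
      Sum.elim s fun _ => false := by
    funext w
    rcases w with w | w <;> rfl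
  have key := run_map_apply ⟨φ, hinj⟩ l (Sum.elim q fun _ => false)
  rw [hstart, hl] at key
  simp only [Function.Embedding.coeFn_mk] at key
  funext w
  rcases w with w | w | w
  · have := key (Sum.inl (e w))
    rwa [hφ, Sum.elim_inl, h₁ s hs, hsq] at this
  · by_cases hw : ∃ q, e q = w
    · obtain ⟨q', rfl⟩ := hw
      refine run_map_of_notMem _ l _ ?_
      intro v hv
      rcases v with v | v
      · by_cases h : ∃ q, e q = v
        · obtain ⟨q'', rfl⟩ := h
          simp [hφ] at hv
        · push Not at h
          simp only [Function.Embedding.coeFn_mk, hφ' v h] at hv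
          exact h q' (Sum.inl.inj (Sum.inr.inj hv)).symm
      · simp [φ] at hv
    · push Not at hw
      have := key (Sum.inl w)
      rwa [hφ' w hw, Sum.elim_inl, h₂ s hs w hw] at this
  · exact key (Sum.inr w)

/-- A family of single-bit updates `s (t i) ↦ s (t i) ⊕ h i s`, none of which reads a target bit,
acts as the simultaneous update. -/
theorem xorFamily {ι : Type} [Fintype ι] (t : ι ↪ Q) (h : ι → (Q → Bool) → Bool) {c : ℕ}
    (hone : ∀ i, Realizes (fun s => Function.update s (t i) (xor (s (t i)) (h i s))) 0 c)
    (hind : ∀ i s s', (∀ w, (∀ j, t j ≠ w) → s w = s' w) → h i s = h i s')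
    {σ : (Q → Bool) → (Q → Bool)} (hσ : ∀ s i, σ s (t i) = xor (s (t i)) (h i s))
    (hσ' : ∀ s w, (∀ i, t i ≠ w) → σ s w = s w) :
    Realizes σ 0 (Fintype.card ι * c) := by
  classical
  have key : ∀ S : Finset ι, ∃ ρ : (Q → Bool) → (Q → Bool), Realizes ρ 0 (S.card * c) ∧
      (∀ s i, ρ s (t i) = if i ∈ S then xor (s (t i)) (h i s) else s (t i)) ∧
      ∀ s w, (∀ i, t i ≠ w) → ρ s w = s w := by
    intro S
    induction S using Finset.induction_on with
    | empty => exact ⟨_, by simpa using Realizes.id, fun s i => by simp, fun s w _ => rfl⟩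
    | insert j S hj ih =>
      obtain ⟨ρ, hρ, hρ₁, hρ₂⟩ := ih
      refine ⟨_, (hρ.comp (hone j)).mono le_rfl ?_, fun s i => ?_, fun s w hw => ?_⟩
      · rw [Finset.card_insert_of_notMem hj]
        linarith
      · have hread : h j (ρ s) = h j s := hind j _ _ fun w hw => hρ₂ s w hw
        by_cases hij : i = j
        · subst hij
          simp [hread, hρ₁, hj]
        · simp [hij, hρ₁]
      · rw [Function.update_of_ne (hw j).symm, hρ₂ s w hw]
  obtain ⟨ρ, hρ, hρ₁, hρ₂⟩ := key Finset.univ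
  have : ρ = σ := by
    funext s w
    by_cases hw : ∃ i, t i = w
    · obtain ⟨i, rfl⟩ := hw
      rw [hρ₁, hσ]
      simp
    · push Not at hw
      rw [hρ₂ s w hw, hσ' s w hw]
  rw [← this]
  exact hρ

theorem inParallel {J : Type} [Fintype J] [DecidableEq J] {σ : (Q → Bool) → (Q → Bool)} {hi : ℕ}
    (hσ : Realizes σ 0 hi) :
    Realizes (MassProduction.inParallel J σ) 0 (Fintype.card J * hi) := by
  have key : ∀ S : Finset J, Realizes
      (fun (s : J × Q → Bool) w => if w.1 ∈ S then σ (fun q => s (w.1, q)) w.2 else s w) 0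
      (S.card * hi) := by
    intro S
    induction S using Finset.induction_on with
    | empty => simpa using Realizes.id
    | insert j S hj ih =>
      have hone : Realizes
          (fun (s : J × Q → Bool) w => if w.1 = j then σ (fun q => s (w.1, q)) w.2 else s w)
          0 hi := by
        refine hσ.lift (Function.Embedding.sectR j Q) (fun s q => ?_)
          (fun s w hw => ?_)
        · simp
        · have : w.1 ≠ j := by
            rintro rfl
            exact hw w.2 rfl
          simp [this]
      rw [Finset.card_insert_of_notMem hj, add_mul, one_mul]
      convert ih.comp hone using 3 with s w
      by_cases hw : w.1 = j
      · simp [hw, hj]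
      · simp [hw]
  have := key Finset.univ
  simp only [Finset.mem_univ, if_true, Finset.card_univ] at this
  exact this

end Realizes

theorem Realizes.exists_circuit {Q : Type} [Fintype Q] [DecidableEq Q]
    {σ : (Q → Bool) → (Q → Bool)} {lo hi : ℕ} (h : Realizes σ lo hi) :
    ∃ C : Circuit Q, C.Implements (classicalOp σ) ∧ lo ≤ C.gates.length ∧ C.gates.length ≤ hi := by
  obtain ⟨A, _, _, l, hl, h₁, h₂⟩ := h
  let e : A ≃ Fin (Fintype.card A) := Fintype.equivFin A
  let φ : Q ⊕ A ≃ Q ⊕ Fin (Fintype.card A) := (Equiv.refl Q).sumCongr e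
  refine ⟨⟨_, (l.map (ClassicalGate.map φ.toEmbedding)).map ClassicalGate.toGate⟩,
    implements_classicalOp fun q => ?_, by simpa using h₁, by simpa using h₂⟩
  have key := ClassicalGate.run_map_apply φ.toEmbedding l (Sum.elim q fun _ => false)
  have hstart : (Sum.elim q fun _ => false) ∘ φ.toEmbedding = Sum.elim q fun _ => false := by
    funext w
    rcases w with w | w <;> rfl
  rw [hstart, hl] at key
  funext w
  rcases w with w | w
  · exact key (Sum.inl w)
  · have := key (Sum.inr (e.symm w))
    simpa [φ] using this

/-! ### The standard QROM circuit -/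

/-- The bit string `s` with `v` XORed into the output register. -/
def xorOutput {n m : ℕ} {A : Type} (v : Fin m → Bool) (s : (Fin n ⊕ Fin m) ⊕ A → Bool) :
    (Fin n ⊕ Fin m) ⊕ A → Bool :=
  Sum.elim (Sum.elim (fun i => s (.inl (.inl i))) fun j => xor (s (.inl (.inr j))) (v j))
    fun i => s (.inr i)

section

variable {n m : ℕ} {A : Type} (v : Fin m → Bool) (s : (Fin n ⊕ Fin m) ⊕ A → Bool)

@[simp] theorem xorOutput_input (i : Fin n) :
    xorOutput v s (.inl (.inl i)) = s (.inl (.inl i)) := rfl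

@[simp] theorem xorOutput_output (j : Fin m) :
    xorOutput v s (.inl (.inr j)) = xor (s (.inl (.inr j))) (v j) := rfl

@[simp] theorem xorOutput_ancilla (i : A) : xorOutput v s (.inr i) = s (.inr i) := rfl

end

theorem run_map_cnot_output {n m : ℕ} {A : Type} [DecidableEq A] (p : A) {js : List (Fin m)}
    (hjs : js.Nodup) (s : (Fin n ⊕ Fin m) ⊕ A → Bool) :
    ClassicalGate.run
        (js.map fun j => ClassicalGate.cnot (Sum.inr p) (Sum.inl (Sum.inr j)) (by simp)) s =
      xorOutput (fun j => s (.inr p) && decide (j ∈ js)) s := by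
  induction js generalizing s with
  | nil =>
    funext w
    rcases w with (w | w) | w <;> simp 
  | cons j js ih =>
    rw [List.nodup_cons] at hjs
    rw [List.map_cons, ClassicalGate.run_cons, ih hjs.2]
    funext w
    rcases w with (w | w) | w
    · simp 
    · by_cases hw : w = j
      · subst hw
        simp [hjs.1]
      · simp [hw]
    · simp 

/-- Unary iteration over the lowest `k` address bits consists of classical gates and XORs `f` into
the output register if ancilla `k` is set; `f` is evaluated at the address whose lowest `k` bits are
read from the register and whose other bits are those of `x`. The number `L k` of gates satisfies
`L (k + 1) + 5 = (L k + 5) + (L' k + 5)`, where `L k` and `L' k` belong to the two recursive calls,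
which is why it is bounded with the offset `5`. -/
theorem exists_run_eq_unaryIteration {n m : ℕ} (f : BoolFun n m) (k : ℕ) (hk : k ≤ n)
    (x : Fin n → Bool) :
    ∃ l : List (ClassicalGate ((Fin n ⊕ Fin m) ⊕ Fin (n + 1))),
      l.map ClassicalGate.toGate = unaryIteration f k hk x ∧
      5 * 2 ^ k ≤ l.length + 5 ∧ l.length + 5 ≤ (5 + m) * 2 ^ k ∧
      ∀ s, (∀ i : Fin (n + 1), (i : ℕ) < k → s (.inr i) = false) →
        ClassicalGate.run l s =
          xorOutput (fun j => s (.inr ⟨k, Nat.lt_succ_of_le hk⟩) &&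
            f (fun i => if (i : ℕ) < k then s (.inl (.inl i)) else x i) j) s := by
  induction k generalizing x with
  | zero =>
    refine ⟨((List.finRange m).filter fun j => f x j).map fun j =>
      .cnot (Sum.inr 0) (Sum.inl (Sum.inr j)) (by simp), ?_, by simp, ?_, fun s _ => ?_⟩
    · simp only [unaryIteration, List.map_map]
      rfl
    · have := List.length_filter_le (fun j => f x j) (List.finRange m)
      simp only [List.length_map, List.length_finRange] at this ⊢
      omega
    · rw [run_map_cnot_output 0 ((List.nodup_finRange m).filter _)]
      simp
  | succ k ih =>
    let i : Fin n := ⟨k, hk⟩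
    let bit : (Fin n ⊕ Fin m) ⊕ Fin (n + 1) := Sum.inl (Sum.inl i)
    let ctrl : (Fin n ⊕ Fin m) ⊕ Fin (n + 1) := Sum.inr i.succ
    let next : (Fin n ⊕ Fin m) ⊕ Fin (n + 1) := Sum.inr i.castSucc
    have hcn : ctrl ≠ next := by simp [ctrl, next, Fin.ext_iff]
    obtain ⟨l₀, hl₀, hlo₀, hhi₀, hrun₀⟩ :=
      ih (Nat.le_of_succ_le hk) (Function.update x i false)
    obtain ⟨l₁, hl₁, hlo₁, hhi₁, hrun₁⟩ :=
      ih (Nat.le_of_succ_le hk) (Function.update x i true)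
    let and : ClassicalGate ((Fin n ⊕ Fin m) ⊕ Fin (n + 1)) :=
      .toffoli ctrl bit next (by simp [ctrl, bit]) hcn (by simp [bit, next])
    refine ⟨[.not bit, and, .not bit] ++ l₀ ++ [.cnot ctrl next hcn] ++ l₁ ++ [and], ?_, ?_, ?_,
      fun s hs => ?_⟩
    · simp only [List.map_append, hl₀, hl₁]
      rfl
    · simp only [List.length_append, List.length_cons, List.length_nil, pow_succ]
      omega
    · simp only [List.length_append, List.length_cons, List.length_nil, pow_succ]
      rw [← mul_assoc]
      omega
    · have hnext : s next = false := hs _ (by simp [i])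
      -- `next` holds the conjunction of `ctrl` with the bit being `0`.
      let s₁ := Function.update s next (s ctrl && !s bit)
      have h₁ : ClassicalGate.run [.not bit, and, .not bit] s = s₁ := by
        funext w
        by_cases hw : w = bit
        · subst hw
          simp [s₁, and, bit, next]
        · by_cases hw' : w = next
          · subst hw'
            simp only [next] at hnext
            simp [s₁, and, bit, ctrl, hnext, next]
          · simp [s₁, and, hw, hw']
      have hs₁ : ∀ j : Fin (n + 1), (j : ℕ) < k → s₁ (.inr j) = false := fun j hj => by
        have : (Sum.inr j : (Fin n ⊕ Fin m) ⊕ Fin (n + 1)) ≠ next := by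
          simp [next, Fin.ext_iff, i, hj.ne]
        rw [show s₁ (.inr j) = s (.inr j) from Function.update_of_ne this _ _]
        exact hs j (hj.trans (Nat.lt_succ_self k))
      let s₂ := ClassicalGate.run l₀ s₁
      -- `next` holds the conjunction of `ctrl` with the bit being `1`.
      let s₃ := (ClassicalGate.cnot ctrl next hcn).act s₂
      have hs₃ : ∀ j : Fin (n + 1), (j : ℕ) < k → s₃ (.inr j) = false := fun j hj => by
        have : (Sum.inr j : (Fin n ⊕ Fin m) ⊕ Fin (n + 1)) ≠ next := by
          simp [next, Fin.ext_iff, i, hj.ne]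
        rw [show s₃ (.inr j) = s₂ (.inr j) from Function.update_of_ne this _ _]
        simp only [s₂, hrun₀ s₁ hs₁]
        exact hs₁ j hj
      have hrun : ClassicalGate.run
          ([.not bit, and, .not bit] ++ l₀ ++ [.cnot ctrl next hcn] ++ l₁ ++ [and]) s =
          and.act (ClassicalGate.run l₁ s₃) := by
        simp only [ClassicalGate.run_append, h₁]
        rfl
      -- The branch selected by bit `k` evaluates `f` at the right address.
      have haddr : ∀ b, s bit = b → (fun j : Fin n => if (j : ℕ) < k + 1 then s (.inl (.inl j))
          else x j) = fun j : Fin n => if (j : ℕ) < k then s (.inl (.inl j))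
          else Function.update x i b j := by
        rintro b rfl
        funext j
        rcases lt_trichotomy (j : ℕ) k with hj | hj | hj
        · simp [hj, hj.trans (Nat.lt_succ_self k)]
        · obtain rfl : j = i := Fin.ext hj
          simp [i, bit]
        · have : j ≠ i := fun h => by simp [h, i] at hj
          simp [this, hj.not_gt, (Nat.succ_le_of_lt hj).not_gt]
      rw [hrun, hrun₁ s₃ hs₃]
      have hk' : (⟨k, Nat.lt_succ_of_le (Nat.le_of_succ_le hk)⟩ : Fin (n + 1)) = i.castSucc := rfl
      have hk'' : (⟨k + 1, Nat.lt_succ_of_le hk⟩ : Fin (n + 1)) = i.succ := rfl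
      have hctrl : s₃ ctrl = s ctrl := by
        simp [s₃, s₂, hrun₀ s₁ hs₁, s₁, hcn, ctrl, next]
      have hnext₁ : s₁ next = (s ctrl && !s bit) := Function.update_self ..
      have hnext₃ : s₃ next = (s ctrl && s bit) := by
        have h₂ : s₂ next = s₁ next := by simp [s₂, hrun₀ s₁ hs₁, next]
        have h₃ : s₂ ctrl = s ctrl := by
          simp [s₂, hrun₀ s₁ hs₁, s₁, hcn, ctrl, next]
        have : s₃ next = xor (s₂ next) (s₂ ctrl) := Function.update_self ..
        rw [this, h₂, h₃, hnext₁]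
        cases s ctrl <;> cases s bit <;> rfl
      have hin : ∀ j, s₃ (.inl (.inl j)) = s (.inl (.inl j)) := fun j => by
        simp [s₃, s₂, hrun₀ s₁ hs₁, s₁, next]
      have hout : ∀ j, s₃ (.inl (.inr j)) = xor (s (.inl (.inr j))) (s₁ next &&
          f (fun j => if (j : ℕ) < k then s (.inl (.inl j)) else Function.update x i false j) j) :=
          fun j => by
        simp [s₃, s₂, hrun₀ s₁ hs₁, s₁, next, hk']
      have hanc : ∀ j, j ≠ i.castSucc → s₃ (.inr j) = s (.inr j) := fun j hj => by
        simp [s₃, s₂, hrun₀ s₁ hs₁, s₁, next, hj]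
      rw [hk', hk'']
      change and.act (xorOutput (fun j => s₃ next && _) s₃) = xorOutput (fun j => s ctrl && _) s
      funext w
      rcases w with (w | w) | w
      · simp [and, next, hin]
      · simp only [hin, hnext₃]
        simp only [and, next, ClassicalGate.act_toffoli, xorOutput_output, hout, hnext₁,
          ne_eq, reduceCtorEq, not_false_eq_true, Function.update_of_ne]
        cases hb : s bit
        · rw [haddr false hb]
          cases s ctrl <;> simp
        · rw [haddr true hb]
          cases s ctrl <;> simp
      · by_cases hw : w = i.castSucc
        · subst hw
          refine (Function.update_self ..).trans ?_
          change xor (s₃ next) (s₃ ctrl && s₃ bit) = s next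
          rw [hctrl, hnext₃, show s₃ bit = s bit from hin i, hnext, Bool.xor_self]
        · simp [and, next, hw, hanc]

theorem exists_run_eq_qrom {n m : ℕ} (f : BoolFun n m) :
    ∃ l : List (ClassicalGate ((Fin n ⊕ Fin m) ⊕ Fin (n + 1))),
      l.map ClassicalGate.toGate = (qrom f).gates ∧
      2 ^ n ≤ l.length ∧ l.length ≤ (5 + m) * 2 ^ n ∧
      ∀ s, ClassicalGate.run l (Sum.elim s fun _ => false) =
        Sum.elim (Sum.elim (fun i => s (.inl i))
          fun j => xor (s (.inr j)) (f (fun i => s (.inl i)) j)) fun _ => false := by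
  obtain ⟨l, hl, hlo, hhi, hrun⟩ := exists_run_eq_unaryIteration f n le_rfl fun _ => false
  have hpos : 1 ≤ 2 ^ n := Nat.one_le_two_pow
  refine ⟨[.not (.inr (Fin.last n))] ++ l ++ [.not (.inr (Fin.last n))], ?_, ?_, ?_, fun s => ?_⟩
  · simp only [List.map_append, hl]
    rfl
  · simp only [List.length_append, List.length_cons, List.length_nil]
    omega
  · simp only [List.length_append, List.length_cons, List.length_nil]
    omega
  · simp only [ClassicalGate.run_append, ClassicalGate.run_cons, ClassicalGate.run_nil]
    rw [hrun]
    · funext w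
      rcases w with (w | w) | w
      -- Here `Sum.update_elim_inr` makes `simp` loop.
      · simp [-Sum.update_elim_inr]
      · have : (⟨n, Nat.lt_succ_of_le le_rfl⟩ : Fin (n + 1)) = Fin.last n := rfl
        simp [-Sum.update_elim_inr, this]
      · by_cases hw : w = Fin.last n
        · subst hw
          simp [-Sum.update_elim_inr]
        · simp [-Sum.update_elim_inr, hw]
    · intro i hi
      have : i ≠ Fin.last n := fun h => by simp [h] at hi
      simp [this]

theorem qrom_implements {n m : ℕ} (f : BoolFun n m) : (qrom f).Implements (oracle f) := by
  obtain ⟨l, hl, -, -, hrun⟩ := exists_run_eq_qrom f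
  have : qrom f = Circuit.mk (n + 1) (l.map ClassicalGate.toGate) := by
    rw [hl]
    rfl
  rw [this]
  exact implements_classicalOp hrun

theorem length_qrom_bounds {n m : ℕ} (f : BoolFun n m) :
    2 ^ n ≤ (qrom f).gates.length ∧ (qrom f).gates.length ≤ (5 + m) * 2 ^ n := by
  obtain ⟨l, hl, hlo, hhi, -⟩ := exists_run_eq_qrom f
  have := congrArg List.length hl
  rw [List.length_map] at this
  exact ⟨hlo.trans_eq this, this.symm.trans_le hhi⟩

/-! ### Parallel queries -/

/-- The query `(x, α) ↦ (x, α ⊕ f x)`. -/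
def queryMap {A B : Type} (f : (A → Bool) → (B → Bool)) (s : A ⊕ B → Bool) : A ⊕ B → Bool
  | .inl a => s (.inl a)
  | .inr b => xor (s (.inr b)) (f (fun a => s (.inl a)) b)

theorem oracle_eq_classicalOp {n m : ℕ} (f : BoolFun n m) :
    oracle f = classicalOp (queryMap f) := by
  unfold oracle
  congr 1
  funext s w
  rcases w with w | w <;> rfl

theorem tensorPower_classicalOp {Q : Type} [Fintype Q] [DecidableEq Q] (r : ℕ)
    (σ : (Q → Bool) → (Q → Bool)) :
    tensorPower r (classicalOp σ) = classicalOp (inParallel (Fin r) σ) := by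
  ext x y
  simp only [tensorPower, classicalOp, Matrix.of_apply, Finset.prod_ite_zero, Finset.mem_univ,
    forall_const, Finset.prod_const_one]
  refine if_congr ⟨fun h => funext fun w => congrFun (h w.1) w.2, ?_⟩ rfl rfl
  rintro rfl i
  rfl

theorem Realizes.inParallel_lift {Q Q' J : Type} [DecidableEq Q] [DecidableEq Q'] [DecidableEq J]
    {σ : (Q → Bool) → (Q → Bool)} {τ : (Q' → Bool) → (Q' → Bool)} {lo hi : ℕ}
    (hσ : Realizes (MassProduction.inParallel J σ) lo hi) (e : Q ↪ Q')
    (h₁ : ∀ s q, τ s (e q) = σ (fun q => s (e q)) q)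
    (h₂ : ∀ s w, (∀ q, e q ≠ w) → τ s w = s w) :
    Realizes (MassProduction.inParallel J τ) lo hi := by
  refine hσ.lift ((Function.Embedding.refl J).prodMap e) (fun s q => h₁ _ _) fun s w hw => ?_
  refine h₂ _ _ fun q hq => hw (w.1, q) ?_
  exact Prod.ext rfl hq

/-! ### Two queries from one query to each of three restrictions -/

/-- The bits of two queries `false` and `true`, whose addresses consist of a leading bit `none` and
the bits `A`, together with an ancilla copy of the bits `A`. -/
abbrev PairWire (A B : Type) : Type := (Bool × (Option A ⊕ B)) ⊕ A

namespace PairWire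

variable {A B : Type}

/-- The leading address bit of query `c`. -/
def lead (c : Bool) : PairWire A B := .inl (c, .inl none)

/-- The register of query `c` without its leading address bit. -/
def reg (c : Bool) : A ⊕ B ↪ PairWire A B where
  toFun u := .inl (c, u.map some id)
  inj' u v h := by
    rcases u with u | u <;> rcases v with v | v <;> simp_all

/-- The ancilla address bits with the output of the second query. -/
def ancReg : A ⊕ B ↪ PairWire A B where
  toFun u := u.elim (fun a => .inr a) (fun b => .inl (true, .inr b))
  inj' u v h := by
    rcases u with u | u <;> rcases v with v | v <;> simp_all

@[simp] theorem reg_inl (c : Bool) (a : A) :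
    (reg c (.inl a) : PairWire A B) = .inl (c, .inl (some a)) := rfl

@[simp] theorem reg_inr (c : Bool) (b : B) :
    (reg c (.inr b) : PairWire A B) = .inl (c, .inr b) := rfl

@[simp] theorem reg_ne_reg (u v : A ⊕ B) : reg false u ≠ reg true v := by
  rcases u with a | b <;> rcases v with a' | b' <;> simp

@[simp] theorem reg_ne_lead (c c' : Bool) (u : A ⊕ B) : reg c u ≠ lead c' := by
  rcases u with a | b <;> simp [lead]

@[simp] theorem ancReg_inl (a : A) : (ancReg (.inl a) : PairWire A B) = .inr a := rfl

@[simp] theorem ancReg_inr (b : B) : (ancReg (.inr b) : PairWire A B) = .inl (true, .inr b) := rfl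

/-- Adds the second register to the first one. -/
def addStep (s : PairWire A B → Bool) : PairWire A B → Bool
  | .inl (false, .inl (some a)) => xor (s (.inl (false, .inl (some a))))
      (s (.inl (true, .inl (some a))))
  | .inl (false, .inr b) => xor (s (.inl (false, .inr b))) (s (.inl (true, .inr b)))
  | w => s w

/-- Adds the first register to the second one if the leading bit of the first query is set. -/
def condAddStep (s : PairWire A B → Bool) : PairWire A B → Bool
  | .inl (true, .inl (some a)) => xor (s (.inl (true, .inl (some a))))
      (s (lead false) && s (.inl (false, .inl (some a))))
  | .inl (true, .inr b) => xor (s (.inl (true, .inr b)))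
      (s (lead false) && s (.inl (false, .inr b)))
  | w => s w

/-- Exchanges the two registers if the leading bit of the first query is set. -/
def swapStep (s : PairWire A B → Bool) : PairWire A B → Bool
  | .inl (c, .inl (some a)) => s (.inl (xor c (s (lead false)), .inl (some a)))
  | .inl (c, .inr b) => s (.inl (xor c (s (lead false)), .inr b))
  | w => s w

/-- Adds `z` to the output of the second query if its leading bit is set. -/
def maskStep (z : B → Bool) (s : PairWire A B → Bool) : PairWire A B → Bool
  | .inl (true, .inr b) => xor (s (.inl (true, .inr b))) (s (lead true) && z b)
  | w => s w

/-- Adds the address of the second query to the ancilla bits if its leading bit is set. -/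
def copyStep (s : PairWire A B → Bool) : PairWire A B → Bool
  | .inr a => xor (s (.inr a)) (s (lead true) && s (.inl (true, .inl (some a))))
  | w => s w

section

variable [DecidableEq A] [DecidableEq B]

/-- Replaces the leading bit of the second query by the bit that tells whether the leading bits
agree. In that case, the address of the second query is copied to the ancilla bits; otherwise, `z`
is added to the output of the second query. -/
def selectStep (z : B → Bool) (s : PairWire A B → Bool) : PairWire A B → Bool :=
  let s₁ := maskStep z (Function.update s (lead true) (xor (s (lead true)) (s (lead false))))
  copyStep (Function.update s₁ (lead true) (!s₁ (lead true)))

/-- Undoes `selectStep 0`. -/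
def unselectStep (s : PairWire A B → Bool) : PairWire A B → Bool :=
  let s₁ := Function.update (copyStep s) (lead true) (!copyStep s (lead true))
  Function.update s₁ (lead true) (xor (s₁ (lead true)) (s₁ (lead false)))

end

/-- Queries `f` in register `c`, that is, without the leading address bit. -/
def loadStep (c : Bool) (f : (A → Bool) → (B → Bool)) (s : PairWire A B → Bool) :
    PairWire A B → Bool
  | .inl (c', .inr b) => xor (s (.inl (c', .inr b)))
      (decide (c' = c) && f (fun a => s (.inl (c, .inl (some a)))) b)
  | w => s w

/-- Queries `f` at the ancilla address, with the output of the second query as target. -/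
def loadAncStep (f : (A → Bool) → (B → Bool)) (s : PairWire A B → Bool) : PairWire A B → Bool
  | .inl (true, .inr b) => xor (s (.inl (true, .inr b))) (f (fun a => s (.inr a)) b)
  | w => s w

end PairWire

open PairWire

variable {A B : Type}

/-- The function obtained from `f` by fixing the leading address bit. -/
def restrictLead (f : (Option A → Bool) → (B → Bool)) (c : Bool) : (A → Bool) → (B → Bool) :=
  fun v => f fun o => o.elim c v

/-- The sum of the two restrictions of `f`. -/
def restrictDiff (f : (Option A → Bool) → (B → Bool)) : (A → Bool) → (B → Bool) :=
  fun v b => xor (restrictLead f false v b) (restrictLead f true v b)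

section

variable [DecidableEq A] [DecidableEq B]

/-- Two queries to `f` from one query to each of `f₀ = restrictLead f false`,
`f₁ = restrictLead f true` and `f₀ ⊕ f₁`. If the first query has leading bit `c`, it is answered by
`f_c`, and `f_{1-c}` is applied to the second query. This is the correct restriction unless the
leading bits agree; in that case `f₀ ⊕ f₁` at the second address corrects the answer. If they
differ, the third query is made at the ancilla address `0`, and its effect is the constant
`(f₀ ⊕ f₁) 0`, which `selectStep` has cancelled beforehand. -/
def pairStep (f : (Option A → Bool) → (B → Bool)) (s : PairWire A B → Bool) : PairWire A B → Bool :=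
  unselectStep (loadAncStep (restrictDiff f) (selectStep (restrictDiff f fun _ => false)
    (swapStep (loadStep true (restrictLead f true) (loadStep false (restrictLead f false)
      (swapStep s))))))

theorem pairStep_query (f : (Option A → Bool) → (B → Bool)) {s : PairWire A B → Bool}
    (hs : ∀ a, s (.inr a) = false) (c : Bool) (w : Option A ⊕ B) :
    pairStep f s (.inl (c, w)) = queryMap f (fun w => s (.inl (c, w))) w := by
  have hlead : ∀ c, (fun o => s (.inl (c, .inl o))) =
      fun o => o.elim (s (lead c)) fun a => s (.inl (c, .inl (some a))) := by
    intro c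
    funext o
    cases o <;> rfl
  rcases w with (_ | a) | b <;> cases c <;> cases hx : s (lead false) <;> cases hy : s (lead true) <;>
    simp only [lead] at hx hy <;>
    simp [pairStep, queryMap, hlead, unselectStep, loadAncStep, selectStep, swapStep, loadStep,
      maskStep, copyStep, lead, restrictDiff, restrictLead, hx, hy, hs,
      Bool.bne_eq_xor, Bool.xor_comm, Bool.xor_left_comm]

theorem pairStep_ancilla (f : (Option A → Bool) → (B → Bool)) {s : PairWire A B → Bool}
    (hs : ∀ a, s (.inr a) = false) (a : A) : pairStep f s (.inr a) = false := by
  cases hx : s (lead false) <;> cases hy : s (lead true) <;>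
    simp only [lead] at hx hy <;>
    simp [pairStep, unselectStep, loadAncStep, selectStep, swapStep, loadStep,
      maskStep, copyStep, lead, hx, hy, hs]

end

variable [DecidableEq A] [DecidableEq B]

theorem realizes_addStep [Fintype A] [Fintype B] :
    Realizes (addStep : (PairWire A B → Bool) → _) 0 (Fintype.card A + Fintype.card B) := by
  have := Realizes.xorFamily (reg false) (fun u (s : PairWire A B → Bool) => s (reg true u))
    (c := 1) (σ := addStep) (fun i => (Realizes.cnot (reg_ne_reg i i).symm).mono zero_le_one le_rfl)
    (fun i s s' h => h _ fun j => reg_ne_reg j i)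
    (fun s i => by rcases i with i | i <;> rfl) (fun s w hw => by
      rcases w with ⟨_ | _, (_ | a) | b⟩ | a
      · rfl
      · exact (hw (.inl a) rfl).elim
      · exact (hw (.inr b) rfl).elim
      all_goals rfl)
  simpa using this

theorem realizes_condAddStep [Fintype A] [Fintype B] :
    Realizes (condAddStep : (PairWire A B → Bool) → _) 0 (Fintype.card A + Fintype.card B) := by
  have := Realizes.xorFamily (reg true)
    (fun u (s : PairWire A B → Bool) => s (lead false) && s (reg false u))
    (c := 1) (σ := condAddStep) (fun i => (Realizes.toffoli (reg_ne_lead _ _ i).symm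
      (reg_ne_lead _ _ i).symm (reg_ne_reg i i)).mono zero_le_one le_rfl)
    (fun i s s' h => by rw [h _ fun j => reg_ne_lead _ _ j, h _ fun j => (reg_ne_reg i j).symm])
    (fun s i => by rcases i with i | i <;> rfl) (fun s w hw => by
      rcases w with ⟨_ | _, (_ | a) | b⟩ | a
      rotate_left 4
      · exact (hw (.inl a) rfl).elim
      · exact (hw (.inr b) rfl).elim
      all_goals rfl)
  simpa using this

theorem realizes_swapStep [Fintype A] [Fintype B] :
    Realizes (swapStep : (PairWire A B → Bool) → _) 0 (3 * (Fintype.card A + Fintype.card B)) := by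
  have h := (realizes_addStep (A := A) (B := B)).comp
    (realizes_condAddStep.comp realizes_addStep)
  convert h using 1
  · funext s w
    rcases w with ⟨_ | _, (_ | a) | b⟩ | a <;> cases hx : s (lead false) <;>
      simp only [lead] at hx <;> simp [swapStep, addStep, condAddStep, lead, hx,
        Bool.xor_comm, Bool.xor_left_comm]
  · ring

theorem realizes_maskStep [Fintype B] (z : B → Bool) :
    Realizes (maskStep z : (PairWire A B → Bool) → _) 0 (Fintype.card B) := by
  have := Realizes.xorFamily (Function.Embedding.inr.trans (reg true))
    (fun b (s : PairWire A B → Bool) => s (lead true) && z b)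
    (c := 1) (σ := maskStep z) (fun b => by
      cases hb : z b
      · simpa using Realizes.id.mono le_rfl zero_le_one
      · simpa [hb] using (Realizes.cnot (reg_ne_lead true true (.inr b)).symm).mono zero_le_one le_rfl)
    (fun i s s' h => by rw [h _ fun j => reg_ne_lead _ _ _])
    (fun s i => rfl) (fun s w hw => by
      rcases w with ⟨_ | _, (_ | a) | b⟩ | a
      rotate_left 5
      · exact (hw b rfl).elim
      all_goals rfl)
  simpa using this

theorem realizes_copyStep [Fintype A] :
    Realizes (copyStep : (PairWire A B → Bool) → _) 0 (Fintype.card A) := by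
  have := Realizes.xorFamily (Function.Embedding.inl.trans (ancReg (A := A) (B := B)))
    (fun a s => s (lead true) && s (.inl (true, .inl (some a))))
    (c := 1) (σ := copyStep) (fun a => (Realizes.toffoli (by simp [lead])
      (by simp [lead]) (by simp)).mono zero_le_one le_rfl)
    (fun i s s' h => by rw [h _ (by simp [lead]), h _ (by simp)])
    (fun s i => rfl) (fun s w hw => by
      rcases w with ⟨_ | _, (_ | a) | b⟩ | a
      rotate_left 6
      · exact (hw a rfl).elim
      all_goals rfl)
  simpa using this

theorem realizes_selectStep [Fintype A] [Fintype B] (z : B → Bool) :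
    Realizes (selectStep z : (PairWire A B → Bool) → _) 0
      (Fintype.card A + Fintype.card B + 2) := by
  refine (((Realizes.cnot (by simp [lead])).comp (realizes_maskStep z)).comp
    ((Realizes.not (lead true)).comp realizes_copyStep)).mono (Nat.zero_le _) ?_
  linarith

theorem realizes_unselectStep [Fintype A] :
    Realizes (unselectStep : (PairWire A B → Bool) → _) 0 (Fintype.card A + 2) := by
  refine ((realizes_copyStep.comp (Realizes.not (lead true))).comp
    (Realizes.cnot (by simp [lead]))).mono (Nat.zero_le _) ?_
  linarith

variable {J : Type} [DecidableEq J]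

theorem realizes_loadStep (c : Bool) {f : (A → Bool) → (B → Bool)} {lo hi : ℕ}
    (hf : Realizes (inParallel J (queryMap f)) lo hi) :
    Realizes (inParallel J (loadStep c f)) lo hi := by
  refine hf.inParallel_lift (reg c) (fun s q => ?_) (fun s w hw => ?_)
  · rcases q with a | b
    · rfl
    · simp [loadStep, queryMap]
  · rcases w with ⟨c', (_ | a) | b⟩ | a
    · rfl
    · rfl
    · have : c' ≠ c := fun h => hw (.inr b) (by rw [h]; rfl)
      simp [loadStep, this]
    · rfl

theorem realizes_loadAncStep {f : (A → Bool) → (B → Bool)} {lo hi : ℕ}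
    (hf : Realizes (inParallel J (queryMap f)) lo hi) :
    Realizes (inParallel J (loadAncStep f)) lo hi := by
  refine hf.inParallel_lift ancReg (fun s q => ?_) (fun s w hw => ?_)
  · rcases q with a | b <;> rfl
  · rcases w with ⟨_ | _, (_ | a) | b⟩ | a
    rotate_left 5
    · exact (hw (.inr b) rfl).elim
    all_goals rfl

/-- Twice as many queries to a function with one more address bit cost three times as much, up to
the cost of routing the addresses. -/
theorem Realizes.queryMap_succ [Fintype J] [Fintype A] [Fintype B] {lo hi : ℕ}
    (h : ∀ f : (A → Bool) → (B → Bool),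
      Realizes (MassProduction.inParallel J (queryMap f)) lo hi)
    (f : (Option A → Bool) → (B → Bool)) :
    Realizes (MassProduction.inParallel (J × Bool) (queryMap f)) (3 * lo)
      (3 * hi + Fintype.card J * (8 * (Fintype.card A + Fintype.card B + 1))) := by
  have hswap := (realizes_swapStep (A := A) (B := B)).inParallel (J := J)
  have hpair := ((((hswap.comp (realizes_loadStep false (h (restrictLead f false)))).comp
    (realizes_loadStep true (h (restrictLead f true)))).comp hswap).comp
    ((realizes_selectStep (A := A) (restrictDiff f fun _ => false)).inParallel (J := J))).comp
    (realizes_loadAncStep (h (restrictDiff f))) |>.comp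
    ((realizes_unselectStep (A := A) (B := B)).inParallel (J := J))
  -- Steps applied to all pairs in parallel compose pair by pair.
  simp only [inParallel_comp] at hpair
  have hpair' : Realizes (MassProduction.inParallel J (pairStep f)) _ _ := hpair
  let e : (J × Bool) × (Option A ⊕ B) ↪ J × PairWire A B :=
    ⟨fun w => (w.1.1, .inl (w.1.2, w.2)), by
      rintro ⟨⟨j, c⟩, w⟩ ⟨⟨j', c'⟩, w'⟩ h
      simpa [and_assoc] using h⟩
  have hanc : ∀ s : J × PairWire A B → Bool, (∀ w, (∀ q, e q ≠ w) → s w = false) →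
      ∀ j a, s (j, .inr a) = false := fun s hs j a => hs _ fun q hq => by
    cases (Prod.ext_iff.1 hq).2
  refine (hpair'.restrict e (τ := MassProduction.inParallel (J × Bool) (queryMap f))
    (fun s hs q => ?_) (fun s hs w hw => ?_)).mono ?_ ?_
  · exact pairStep_query f (s := fun p => s (q.1.1, p)) (hanc s hs q.1.1) q.1.2 q.2
  · rcases w with ⟨j, ⟨c, w⟩ | a⟩
    · exact (hw ((j, c), w) rfl).elim
    · exact pairStep_ancilla f (s := fun p => s (j, p)) (hanc s hs j) a
  · linarith
  · nlinarith [Nat.zero_le (Fintype.card J), Nat.zero_le (Fintype.card A),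
      Nat.zero_le (Fintype.card B)]

/-! ### Mass production of queries -/

theorem realizes_queryMap {n m : ℕ} (f : BoolFun n m) :
    Realizes (queryMap f) (2 ^ n) ((5 + m) * 2 ^ n) := by
  obtain ⟨l, -, hlo, hhi, hrun⟩ := exists_run_eq_qrom f
  refine ⟨Fin (n + 1), inferInstance, inferInstance, l, fun s => ?_, hlo, hhi⟩
  rw [hrun]
  funext w
  rcases w with (w | w) | w <;> rfl

/-- Halving the number of queries `k` times leaves `3 ^ k` single queries to functions of `a` bits,
which are answered by unary iteration. -/
theorem realizes_inParallel_queryMap (a m k : ℕ) {n r : ℕ} (hn : n = a + k) (hr : r = 2 ^ k)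
    (f : BoolFun n m) :
    Realizes (inParallel (Fin r) (queryMap f)) (3 ^ k)
      (3 ^ k * ((5 + m) * 2 ^ a + 8 * k * (n + m + 1))) := by
  induction k generalizing n r with
  | zero =>
    obtain rfl : n = a := hn
    obtain rfl : r = 1 := hr
    have h := (realizes_queryMap f).lift (Function.Embedding.sectR (0 : Fin 1) _)
      (τ := inParallel (Fin 1) (queryMap f)) (fun s q => rfl) (fun s w hw => by
        refine (hw w.2 (Prod.ext ?_ rfl)).elim
        exact Subsingleton.elim _ _)
    refine h.mono ?_ ?_
    · simpa using Nat.one_le_two_pow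
    · simp
  | succ k ih =>
    subst hn hr
    have hcard : Fintype.card (Fin (2 ^ (k + 1))) = Fintype.card (Fin (2 ^ k) × Bool) := by
      simp [pow_succ]
    let eJ : Fin (2 ^ (k + 1)) ≃ Fin (2 ^ k) × Bool := Fintype.equivOfCardEq hcard
    let eA : Fin (a + (k + 1)) ≃ Option (Fin (a + k)) := finSuccEquiv (a + k)
    have h := Realizes.queryMap_succ (J := Fin (2 ^ k)) (fun f => ih rfl rfl f)
      (fun (v : Option (Fin (a + k)) → Bool) => f fun i => v (eA i))
    let e := eJ.prodCongr (eA.sumCongr (Equiv.refl (Fin m)))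
    refine (h.restrict e.toEmbedding (τ := inParallel _ (queryMap f)) (fun s _ q => ?_)
      (fun s _ w hw => (hw (e.symm w) (e.apply_symm_apply w)).elim)).mono ?_ ?_
    · obtain ⟨j, i | b⟩ := q <;> rfl
    · rw [pow_succ']
    · have h23 : 2 ^ k ≤ 3 ^ k := Nat.pow_le_pow_left (by norm_num) k
      simp only [Fintype.card_fin]
      calc 3 * (3 ^ k * ((5 + m) * 2 ^ a + 8 * k * (a + k + m + 1))) +
            2 ^ k * (8 * (a + k + m + 1))
          ≤ 3 * (3 ^ k * ((5 + m) * 2 ^ a + 8 * k * (a + k + m + 1))) +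
            3 ^ k * (8 * (a + k + m + 1)) := by gcongr
        _ ≤ 3 ^ k * 3 * ((5 + m) * 2 ^ a + 8 * (k + 1) * (a + k + m + 1)) := by
            have : 0 ≤ 3 ^ k * (16 * (a + k + m + 1)) := Nat.zero_le _
            linarith
        _ ≤ 3 ^ (k + 1) * ((5 + m) * 2 ^ a + 8 * (k + 1) * (a + (k + 1) + m + 1)) := by
            rw [pow_succ]
            gcongr
            omega

/-! ### Costs -/

theorem cliffordCount_add_toffoliCount {Q : Type} (C : Circuit Q) :
    C.cliffordCount + C.toffoliCount = C.gates.length := by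
  rw [List.length_eq_countP_add_countP (fun g => g.isToffoli), add_comm]
  simp [Circuit.cliffordCount, Circuit.toffoliCount]

theorem le_cost {Q : Type} (C : Circuit Q) (Ξ : ℝ) :
    min 1 Ξ * C.gates.length ≤ C.cost Ξ := by
  rw [← cliffordCount_add_toffoliCount, Nat.cast_add, mul_add, Circuit.cost]
  gcongr
  · exact mul_le_of_le_one_left (Nat.cast_nonneg _) (min_le_left _ _)
  · exact min_le_right _ _

theorem cost_le {Q : Type} (C : Circuit Q) (Ξ : ℝ) :
    C.cost Ξ ≤ max 1 Ξ * C.gates.length := by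
  rw [← cliffordCount_add_toffoliCount, Nat.cast_add, mul_add, Circuit.cost]
  gcongr
  · exact le_mul_of_one_le_left (Nat.cast_nonneg _) (le_max_left _ _)
  · exact le_max_right _ _

theorem two_rpow_mul_two_sub_logb (n : ℕ) :
    (2 : ℝ) ^ ((n : ℝ) * (2 - Real.logb 2 3)) = 2 ^ n * 2 ^ n / 3 ^ n := by
  rw [mul_comm, Real.rpow_mul_natCast (by norm_num), Real.rpow_sub (by norm_num),
    Real.rpow_logb (by norm_num) (by norm_num) (by norm_num), div_pow, ← mul_pow]
  norm_num

/-- Gate counts between `3 ^ (n - a)` and `3 ^ (n - a)` times a polynomial in `n` give cost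
`Θ̃(3 ^ n)`. -/
theorem isSoftTheta_cost {a m : ℕ} {Q : ℕ → Type}
    (C : (n : ℕ) → BoolFun n m → Circuit (Q n))
    (hlo : ∀ n, a < n → ∀ f, 3 ^ (n - a) ≤ (C n f).gates.length)
    (hhi : ∀ n, a < n → ∀ f, (C n f).gates.length ≤
      3 ^ (n - a) * ((5 + m) * 2 ^ a + 8 * (n - a) * (n + m + 1))) {Ξ : ℝ} (hΞ : 0 < Ξ) :
    IsSoftTheta a (fun n f => (C n f).cost Ξ) fun n => (3 : ℝ) ^ n := by
  have hmin : 0 < min 1 Ξ := lt_min one_pos hΞ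
  have hmax : 0 < max 1 Ξ := lt_max_of_lt_left one_pos
  refine ⟨3 ^ a / min 1 Ξ + max 1 Ξ * ((5 + m) * 2 ^ a + 8 * (m + 2)), 2, by positivity,
    fun n hn f => ⟨?_, ?_⟩⟩
  · have hn1 : (1 : ℝ) ≤ (n : ℝ) ^ 2 := one_le_pow₀ (by exact_mod_cast (by omega : 1 ≤ n))
    have hlen : (3 : ℝ) ^ (n - a) ≤ (C n f).gates.length := by exact_mod_cast hlo n hn f
    have h3 : (3 : ℝ) ^ n = 3 ^ a * 3 ^ (n - a) := by
      rw [← pow_add, Nat.add_sub_cancel' hn.le]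
    calc (3 : ℝ) ^ n /
          ((3 ^ a / min 1 Ξ + max 1 Ξ * ((5 + m) * 2 ^ a + 8 * (m + 2))) * (n : ℝ) ^ 2)
        ≤ 3 ^ n / (3 ^ a / min 1 Ξ) := by
          gcongr
          calc (3 : ℝ) ^ a / min 1 Ξ
              ≤ 3 ^ a / min 1 Ξ + max 1 Ξ * ((5 + m) * 2 ^ a + 8 * (m + 2)) :=
                le_add_of_nonneg_right (by positivity)
            _ ≤ _ := le_mul_of_one_le_right (by positivity) hn1
      _ = min 1 Ξ * 3 ^ (n - a) := by
          rw [h3]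
          field_simp
      _ ≤ min 1 Ξ * (C n f).gates.length := by gcongr
      _ ≤ _ := le_cost _ _
  · have hn1 : 1 ≤ n := by omega
    have hpoly : (5 + m) * 2 ^ a + 8 * (n - a) * (n + m + 1) ≤
        ((5 + m) * 2 ^ a + 8 * (m + 2)) * n ^ 2 := by
      have h₁ : (5 + m) * 2 ^ a ≤ (5 + m) * 2 ^ a * n ^ 2 :=
        Nat.le_mul_of_pos_right _ (by positivity)
      have h₂ : 8 * (n - a) * (n + m + 1) ≤ 8 * n * (n * (m + 2)) := by
        gcongr
        · omega
        · nlinarith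
      linarith
    have hlen : (C n f).gates.length ≤ 3 ^ n * (((5 + m) * 2 ^ a + 8 * (m + 2)) * n ^ 2) :=
      (hhi n hn f).trans (Nat.mul_le_mul (Nat.pow_le_pow_right (by norm_num) (Nat.sub_le _ _))
        hpoly)
    have hlen' : ((C n f).gates.length : ℝ) ≤
        3 ^ n * (((5 + m) * 2 ^ a + 8 * (m + 2)) * (n : ℝ) ^ 2) := by exact_mod_cast hlen
    calc (C n f).cost Ξ ≤ max 1 Ξ * (C n f).gates.length := cost_le _ _
      _ ≤ max 1 Ξ * (3 ^ n * (((5 + m) * 2 ^ a + 8 * (m + 2)) * (n : ℝ) ^ 2)) := by gcongr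
      _ = max 1 Ξ * ((5 + m) * 2 ^ a + 8 * (m + 2)) * (n : ℝ) ^ 2 * 3 ^ n := by ring
      _ ≤ _ := by
          gcongr
          exact le_add_of_nonneg_left (by positivity)

theorem isSoftTheta_improvementFactor {a m : ℕ} {Q Q' : ℕ → Type} {Ξ : ℝ}
    {D : (n : ℕ) → BoolFun n m → Circuit (Q n)} {C : (n : ℕ) → BoolFun n m → Circuit (Q' n)}
    (hD : IsSoftTheta a (fun n f => (D n f).cost Ξ) fun n => (2 : ℝ) ^ n)
    (hC : IsSoftTheta a (fun n f => (C n f).cost Ξ) fun n => (3 : ℝ) ^ n) :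
    IsSoftTheta a (fun n f => improvementFactor Ξ (2 ^ (n - a)) (D n f) (C n f))
      fun n => (2 : ℝ) ^ ((n : ℝ) * (2 - Real.logb 2 3)) := by
  obtain ⟨K, p, hK, hD⟩ := hD
  obtain ⟨L, q, hL, hC⟩ := hC
  refine ⟨K * L * 2 ^ a, p + q, by positivity, fun n hn f => ?_⟩
  obtain ⟨hD₁, hD₂⟩ := hD n hn f
  obtain ⟨hC₁, hC₂⟩ := hC n hn f
  have hn0 : (0 : ℝ) < n := by exact_mod_cast (by omega : 0 < n)
  have hr : ((2 ^ (n - a) : ℕ) : ℝ) = 2 ^ n / 2 ^ a := by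
    rw [eq_div_iff (by positivity), Nat.cast_pow, Nat.cast_ofNat, ← pow_add,
      Nat.sub_add_cancel hn.le]
  have hC0 : 0 < (C n f).cost Ξ := lt_of_lt_of_le (by positivity) hC₁
  have hD0 : 0 < (D n f).cost Ξ := lt_of_lt_of_le (by positivity) hD₁
  simp only [improvementFactor, hr, two_rpow_mul_two_sub_logb]
  constructor
  · calc (2 : ℝ) ^ n * 2 ^ n / 3 ^ n / (K * L * 2 ^ a * (n : ℝ) ^ (p + q))
        = 2 ^ n / 2 ^ a * (2 ^ n / (K * (n : ℝ) ^ p)) / (L * (n : ℝ) ^ q * 3 ^ n) := by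
          rw [pow_add]
          field_simp
      _ ≤ _ := by gcongr
  · calc (2 : ℝ) ^ n / 2 ^ a * (D n f).cost Ξ / (C n f).cost Ξ
        ≤ 2 ^ n / 1 * (K * (n : ℝ) ^ p * 2 ^ n) / (3 ^ n / (L * (n : ℝ) ^ q)) := by
          gcongr
          exact one_le_pow₀ one_le_two
      _ = K * L * 1 * (n : ℝ) ^ (p + q) * (2 ^ n * 2 ^ n / 3 ^ n) := by
          rw [pow_add]
          field_simp
      _ ≤ _ := by
          gcongr
          exact one_le_pow₀ one_le_two

end MassProduction

theorem mainTheorem2 (a m : ℕ) (ha : 0 < a) :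
    ∃ C : (n : ℕ) → MassProduction.BoolFun n m →
        MassProduction.Circuit (Fin (2 ^ (n - a)) × (Fin n ⊕ Fin m)),
      (∀ n, a < n → ∀ f : MassProduction.BoolFun n m,
        (C n f).Implements
          (MassProduction.tensorPower (2 ^ (n - a)) (MassProduction.oracle f))) ∧
      ∀ Ξ : ℝ, 0 < Ξ →
        MassProduction.IsSoftTheta a (fun n f => (C n f).cost Ξ) (fun n => (3 : ℝ) ^ n) ∧
        (∃ c K : ℝ, 0 < c ∧ 0 < K ∧ ∀ n, ∀ f : MassProduction.BoolFun n m,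
          (MassProduction.qrom f).Implements (MassProduction.oracle f) ∧
          c * 2 ^ n ≤ (MassProduction.qrom f).cost Ξ ∧
          (MassProduction.qrom f).cost Ξ ≤ K * 2 ^ n) ∧
        ∀ D : (n : ℕ) → MassProduction.BoolFun n m → MassProduction.Circuit (Fin n ⊕ Fin m),
          (∀ n, a < n → ∀ f : MassProduction.BoolFun n m,
            (D n f).Implements (MassProduction.oracle f)) →
          MassProduction.IsSoftTheta a (fun n f => (D n f).cost Ξ) (fun n => (2 : ℝ) ^ n) →
          MassProduction.IsSoftTheta a
            (fun n f => MassProduction.improvementFactor Ξ (2 ^ (n - a)) (D n f) (C n f))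
            (fun n => (2 : ℝ) ^ ((n : ℝ) * (2 - Real.logb 2 3))) := by
  have hex : ∀ n, ∀ f : MassProduction.BoolFun n m,
      ∃ C : MassProduction.Circuit (Fin (2 ^ (n - a)) × (Fin n ⊕ Fin m)), a < n →
        C.Implements (MassProduction.tensorPower (2 ^ (n - a)) (MassProduction.oracle f)) ∧
        3 ^ (n - a) ≤ C.gates.length ∧ C.gates.length ≤
          3 ^ (n - a) * ((5 + m) * 2 ^ a + 8 * (n - a) * (n + m + 1)) := by
    intro n f
    by_cases hn : a < n
    · obtain ⟨C, hC, hlo, hhi⟩ := (MassProduction.realizes_inParallel_queryMap a m (n - a)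
        (Nat.add_sub_cancel' hn.le).symm rfl f).exists_circuit
      refine ⟨C, fun _ => ⟨?_, hlo, hhi⟩⟩
      rwa [MassProduction.oracle_eq_classicalOp, MassProduction.tensorPower_classicalOp]
    · exact ⟨⟨0, []⟩, fun h => (hn h).elim⟩
  choose C hC using hex
  refine ⟨C, fun n hn f => (hC n f hn).1, fun Ξ hΞ => ?_⟩
  have hcost := MassProduction.isSoftTheta_cost C (fun n hn f => (hC n f hn).2.1)
    (fun n hn f => (hC n f hn).2.2) hΞ
  have hmin : 0 < min 1 Ξ := lt_min one_pos hΞ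
  have hmax : 0 < max 1 Ξ := lt_max_of_lt_left one_pos
  refine ⟨hcost, ⟨min 1 Ξ, max 1 Ξ * (5 + m), hmin, by positivity, fun n f =>
    ⟨MassProduction.qrom_implements f, ?_, ?_⟩⟩,
    fun D _ hD => MassProduction.isSoftTheta_improvementFactor hD hcost⟩
  · have hlen : (2 : ℝ) ^ n ≤ (MassProduction.qrom f).gates.length := by
      exact_mod_cast (MassProduction.length_qrom_bounds f).1
    exact (mul_le_mul_of_nonneg_left hlen hmin.le).trans (MassProduction.le_cost _ _)
  · have hlen : ((MassProduction.qrom f).gates.length : ℝ) ≤ (5 + m) * 2 ^ n := by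
      exact_mod_cast (MassProduction.length_qrom_bounds f).2
    refine (MassProduction.cost_le _ _).trans ?_
    rw [mul_assoc]
    exact mul_le_mul_of_nonneg_left hlen hmax.le
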